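/- Call a natural number palindromic if its binary representation reads the same forwards and backwards. There is an algorithm that, given a natural number $N$, determines whether $N = A/B$ for some palindromic numbers $A$ and $B$ with $B \neq 0$, and that runs in $O(N^{9/2})$ time. Precisely: there is a single program for the unit-cost random-access machine (one unit of time for each constant assignment, addition, truncated subtraction, multiplication, integer division, indirect read, indirect write, jump, and zero test) that on every input $N \in \mathbb{N}$ halts within $T(N)$ steps and outputs $1$ if $N$ is such a quotient and $0$ if it is not, where $T(N) = O(N^{9/2})$ as $N \to \infty$, and in whose computation on input $N$ all stored numbers and all addresses are bounded by $(N+2)^k$ for a constant $k$ independent of $N$ (that is, machine words have $O(\log N)$ bits). -/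

import Mathlib

/-- A natural number is palindromic if its binary representation reads the same forwards and
backwards. -/
def IsPalindromic (n : ℕ) : Prop :=
  (Nat.digits 2 n).reverse = Nat.digits 2 n

/-- `N` is the quotient `A / B` of two palindromic numbers, with `B ≠ 0`. -/
def IsPalindromicQuotient (N : ℕ) : Prop :=
  ∃ A B : ℕ, IsPalindromic A ∧ IsPalindromic B ∧ B ≠ 0 ∧ (N : ℚ) = (A : ℚ) / (B : ℚ)

namespace RAM

/-- The arithmetic operations of the random-access machine. Subtraction is truncated at `0`;
division is the integer quotient (and a division by `0` returns `0`). -/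
inductive Op where
  | add
  | sub
  | mul
  | div

/-- The value of an arithmetic operation. -/
def Op.eval : Op → ℕ → ℕ → ℕ
  | .add, x, y => x + y
  | .sub, x, y => x - y
  | .mul, x, y => x * y
  | .div, x, y => x / y

/-- The instructions of the random-access machine. -/
inductive Instr where
  /-- `mem[d] := v`, for a constant `v` -/
  | const (d v : ℕ)
  /-- `mem[d] := mem[a] ∘ mem[b]`, for an arithmetic operation `∘` -/
  | arith (o : Op) (d a b : ℕ)
  /-- `mem[d] := mem[mem[a]]` (indirect read) -/
  | load (d a : ℕ)
  /-- `mem[mem[a]] := mem[s]` (indirect write) -/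
  | store (a s : ℕ)
  /-- continue with instruction number `t` -/
  | jump (t : ℕ)
  /-- continue with instruction number `t` if `mem[a] = 0` -/
  | jumpIfZero (a t : ℕ)

/-- A program is a finite list of instructions, numbered from `0`. -/
abbrev Program := List Instr

/-- A configuration: the number of the current instruction and the content of the memory. -/
structure Config where
  pc : ℕ
  mem : ℕ → ℕ

/-- The effect of a single instruction. -/
def Instr.exec (c : Config) : Instr → Config
  | .const d v => ⟨c.pc + 1, Function.update c.mem d v⟩
  | .arith o d a b => ⟨c.pc + 1, Function.update c.mem d (o.eval (c.mem a) (c.mem b))⟩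
  | .load d a => ⟨c.pc + 1, Function.update c.mem d (c.mem (c.mem a))⟩
  | .store a s => ⟨c.pc + 1, Function.update c.mem (c.mem a) (c.mem s)⟩
  | .jump t => ⟨t, c.mem⟩
  | .jumpIfZero a t => ⟨if c.mem a = 0 then t else c.pc + 1, c.mem⟩

/-- One step of computation. The machine has halted, and its configuration no longer changes,
when the current instruction number lies outside the program. -/
def Program.step (P : Program) (c : Config) : Config :=
  match P[c.pc]? with
  | some i => i.exec c
  | none => c

/-- The machine has halted. -/
def Program.Halted (P : Program) (c : Config) : Prop :=
  P.length ≤ c.pc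

/-- The start configuration: the input is in cell `0`, all other cells contain `0`. -/
def start (N : ℕ) : Config :=
  ⟨0, Function.update (fun _ => 0) 0 N⟩

/-- The configuration after `t` steps on input `N`. Each instruction takes one unit of time. -/
def Program.configAt (P : Program) (N t : ℕ) : Config :=
  P.step^[t] (start N)

/-- The program decides the set `S` in time `T` on a unit-cost random-access machine with words of
`O(log N)` bits: on every input `N` it halts after at most `T N` steps, with output (in cell `0`)
equal to `1` if `N ∈ S` and to `0` otherwise, and all numbers that occur in the memory during the
computation (hence also all the addresses used) are bounded by a fixed power of `N + 2`. -/
def Program.DecidesInTime (P : Program) (S : Set ℕ) (T : ℕ → ℕ) : Prop :=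
  (∀ N : ℕ, P.Halted (P.configAt N (T N)) ∧
    (N ∈ S → (P.configAt N (T N)).mem 0 = 1) ∧
    (N ∉ S → (P.configAt N (T N)).mem 0 = 0)) ∧
  ∃ k : ℕ, ∀ N t a : ℕ, (P.configAt N t).mem a ≤ (N + 2) ^ k

end RAM

/-! The case `N = 0` is trivial, and nonzero palindromes are odd, so let `N` be odd. If `N * B = A`,
let `L` be the difference of the digit lengths and `W = 2 ^ L`. With `L` zeros put on top of `B`,
the low-first digit lists of `B` and `A` become lists `bs`, `as` of equal length, both beginning
with `1`. Their values satisfy `N * bs = as`, and the values of the reversed lists satisfy `W *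
as.reverse = N * bs.reverse`. Conversely, any two such lists give palindromes by mirroring: `bs`
followed by its reverse, and `as`, `L` zeros, the reverse of `as`. This is
`isPalindromicQuotient_iff_balanced`.

Checking both equations digit by digit takes only two carries: `c < N` at the low end, and `h` at
the high end, which must stay in `-W < h < N`. Since `W < 2 * N`, a fixed `W` leaves a reachability
question in a graph with `E ≤ 6 * N ^ 2` edges (`reaches_iff_good`). Relaxing all edges `E` times
answers it (`sweep_ne_zero_iff`) at cost `O(N ^ 4)`, and there are `O(log N)` values of `W`; finally
`N ^ 4 * log N = O(N ^ (9 / 2))`.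

On the machine, straight-line blocks are evaluated symbolically (`Computes.straightLine`) and the
two loops are handled by induction (`computes_sweep`, `computes_search`). Between blocks all cells
are at most `(N + 2) ^ 10`; an instruction at most squares this bound and blocks have bounded
length, so words stay polynomial. -/

/-! ### Marking the vertices of a finite graph that reach a target -/

namespace Relaxation

section
variable {α : Type*} (src dst : ℕ → α)

/-- There is a path of at most `k` edges from `s` to `z`. -/
def Within (z : α) : ℕ → α → Prop
  | 0, s => s = z
  | k + 1, s => Within z k s ∨ ∃ i, src i = s ∧ Within z k (dst i)

/-- There is a path from `s` to `z`. -/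
def Reaches (z s : α) : Prop := ∃ k, Within src dst z k s

variable {src dst} in
theorem Within.mono {z s : α} {k l : ℕ} (h : Within src dst z k s) (hkl : k ≤ l) :
    Within src dst z l s := by
  induction hkl with
  | refl => exact h
  | step _ ih => exact Or.inl ih

variable {src dst} in
theorem reaches_of_edge {z : α} (i : ℕ) (h : Reaches src dst z (dst i)) :
    Reaches src dst z (src i) :=
  let ⟨k, hk⟩ := h
  ⟨k + 1, Or.inr ⟨i, rfl, hk⟩⟩

variable [DecidableEq α]

/-- Relaxation of the edge number `i`: its source is marked if its target is. -/
def relax (T : α → ℕ) (i : ℕ) : α → ℕ :=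
  -- With truncated subtraction, `1 - (1 - x)` is `min x 1`.
  Function.update T (src i) (1 - (1 - (T (dst i) + T (src i))))

/-- The edges `n - 1, …, 0` are relaxed in this order. -/
def sweep : ℕ → (α → ℕ) → (α → ℕ)
  | 0, T => T
  | n + 1, T => sweep n (relax src dst T n)

/-- The edges `a + m - 1, …, a` are relaxed in this order. -/
def sweepFrom (a : ℕ) : ℕ → (α → ℕ) → (α → ℕ)
  | 0, T => T
  | m + 1, T => sweepFrom a m (relax src dst T (a + m))

variable {src dst}

theorem relax_ne_zero {T : α → ℕ} {s : α} (i : ℕ) (h : T s ≠ 0) : relax src dst T i s ≠ 0 := by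
  unfold relax
  rcases eq_or_ne s (src i) with rfl | hs
  · simp only [Function.update_self]; omega
  · simpa [Function.update_of_ne hs] using h

theorem sweep_add (a m : ℕ) (T : α → ℕ) :
    sweep src dst (a + m) T = sweep src dst a (sweepFrom src dst a m T) := by
  induction m generalizing T with
  | zero => rfl
  | succ m ih => exact ih _

theorem sweepFrom_ne_zero {s : α} (a m : ℕ) {T : α → ℕ} (h : T s ≠ 0) :
    sweepFrom src dst a m T s ≠ 0 := by
  induction m generalizing T with
  | zero => exact h
  | succ m ih => exact ih (relax_ne_zero _ h)

theorem sweepFrom_src_ne_zero {a m i : ℕ} (hi : a ≤ i) (him : i < a + m) {T : α → ℕ}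
    (h : T (dst i) ≠ 0) : sweepFrom src dst a m T (src i) ≠ 0 := by
  induction m generalizing T with
  | zero => omega
  | succ m ih =>
    rcases eq_or_ne i (a + m) with rfl | hne
    · refine sweepFrom_ne_zero a m ?_
      unfold relax
      simp only [Function.update_self]; omega
    · exact ih (by omega) (relax_ne_zero _ h)

theorem relax_le_one {T : α → ℕ} (h : ∀ s, T s ≤ 1) (i : ℕ) (s : α) :
    relax src dst T i s ≤ 1 := by
  unfold relax
  rcases eq_or_ne s (src i) with rfl | hs
  · simp only [Function.update_self]; omega
  · simpa [Function.update_of_ne hs] using h s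

theorem sweep_le_one (n : ℕ) {T : α → ℕ} (h : ∀ s, T s ≤ 1) (s : α) : sweep src dst n T s ≤ 1 := by
  induction n generalizing T with
  | zero => exact h s
  | succ n ih => exact ih (relax_le_one h n)

theorem sweep_of_forall_ne {s : α} (hs : ∀ i, src i ≠ s) (n : ℕ) (T : α → ℕ) :
    sweep src dst n T s = T s := by
  induction n generalizing T with
  | zero => rfl
  | succ n ih => rw [sweep, ih, relax, Function.update_of_ne (hs n).symm]

/-- Only vertices with a path to the target are marked. -/
theorem reaches_of_sweep_ne_zero {z : α} {V : Set α} (hs : ∀ i, src i ∈ V) (hd : ∀ i, dst i ∈ V)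
    (n : ℕ) {T : α → ℕ} (hT : ∀ s ∈ V, T s ≠ 0 → Reaches src dst z s) {s : α} (hsV : s ∈ V)
    (h : sweep src dst n T s ≠ 0) : Reaches src dst z s := by
  induction n generalizing T with
  | zero => exact hT s hsV h
  | succ n ih =>
    refine ih (fun s hsV hne => ?_) h
    unfold relax at hne
    rcases eq_or_ne s (src n) with rfl | hs'
    · simp only [Function.update_self] at hne
      by_cases h0 : T (dst n) = 0
      · exact hT _ (hs n) (by omega)
      · exact reaches_of_edge n (hT _ (hd n) h0)
    · rw [Function.update_of_ne hs'] at hne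
      exact hT s hsV hne

/-- Each round relaxes every edge once, so it lengthens by one the paths whose sources are certainly
marked. Edges are numbered by all of `ℕ` with period `E`, so one counter serves all rounds. -/
theorem sweep_ne_zero_of_within {z s : α} {E : ℕ} (hsrc : ∀ i, src (i % E) = src i)
    (hdst : ∀ i, dst (i % E) = dst i) (hE : 0 < E) (k n : ℕ) {T : α → ℕ}
    (hT : ∀ s, Within src dst z k s → T s ≠ 0) (h : Within src dst z (k + n) s) :
    sweep src dst (n * E) T s ≠ 0 := by
  induction n generalizing T k with
  | zero => simpa [sweep] using hT s h
  | succ n ih =>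
    rw [Nat.succ_mul, sweep_add]
    refine ih (k + 1) (fun s hs => ?_) (by rwa [add_right_comm, add_assoc])
    rcases hs with hs | ⟨i, rfl, hi⟩
    · exact sweepFrom_ne_zero _ _ (hT s hs)
    · have hmod : (n * E + i % E) % E = i % E := by
        rw [Nat.mul_add_mod_self_right, Nat.mod_mod]
      have h1 : src (n * E + i % E) = src i := by rw [← hsrc, hmod, hsrc]
      have h2 : dst (n * E + i % E) = dst i := by rw [← hdst, hmod, hdst]
      rw [← h1]
      refine sweepFrom_src_ne_zero (Nat.le_add_right _ _) ?_ (h2 ▸ hT _ hi)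
      have := Nat.mod_lt i hE
      omega

omit [DecidableEq α] in
/-- In a graph with `E` edges, a path can be replaced by one of at most `E` edges. -/
theorem Reaches.within {z s : α} {E : ℕ} (hsrc : ∀ i, src (i % E) = src i) (hE : 0 < E)
    (h : Reaches src dst z s) : Within src dst z E s := by
  classical
  let A : ℕ → Finset ℕ := fun k => (Finset.range E).filter fun i => Within src dst z k (src i)
  have hmono : ∀ k, A k ⊆ A (k + 1) := fun k i hi => by
    simp only [A, Finset.mem_filter] at hi ⊢
    exact ⟨hi.1, Or.inl hi.2⟩
  have hmem : ∀ k i, i % E ∈ A k ↔ Within src dst z k (src i) := fun k i => by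
    simp [A, Nat.mod_lt _ hE, hsrc]
  -- The sets `A k` increase inside a set of size `E`: either two consecutive ones agree before
  -- stage `E`, after which nothing new is reached, or `A E` contains every edge.
  have claim : ∀ k, (∃ j < k, A j = A (j + 1)) ∨ k ≤ (A k).card := by
    intro k
    induction k with
    | zero => simp
    | succ k ih =>
      rcases ih with ⟨j, hj, hA⟩ | ih
      · exact Or.inl ⟨j, by omega, hA⟩
      · by_cases hA : A k = A (k + 1)
        · exact Or.inl ⟨k, by omega, hA⟩
        · have := Finset.card_lt_card ((hmono k).ssubset_of_ne hA)
          right; omega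
  obtain ⟨k, hk⟩ := h
  rcases claim E with ⟨j, hj, hA⟩ | hcard
  · have stable : ∀ s, Within src dst z (j + 1) s → Within src dst z j s := by
      rintro s (hs | ⟨i, rfl, hi⟩)
      · exact hs
      · rw [← hmem, hA, hmem]
        exact Or.inr ⟨i, rfl, hi⟩
    have all : ∀ l s, Within src dst z l s → Within src dst z j s := by
      intro l
      induction l with
      | zero => exact fun s hs => Within.mono hs (Nat.zero_le j)
      | succ l ih =>
        rintro s (hs | ⟨i, rfl, hi⟩)
        · exact ih s hs
        · exact stable _ (Or.inr ⟨i, rfl, ih _ hi⟩)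
    exact (all k s hk).mono hj.le
  · have hA : A E = Finset.range E :=
      Finset.eq_of_subset_of_card_le (Finset.filter_subset _ _) (by simpa using hcard)
    have : ∀ i, Within src dst z E (src i) := fun i => by
      rw [← hmem, hA]
      exact Finset.mem_range.2 (Nat.mod_lt _ hE)
    induction k with
    | zero => exact Within.mono hk (Nat.zero_le E)
    | succ k ih =>
      rcases hk with hk | ⟨i, rfl, -⟩
      · exact ih hk
      · exact this i

/-- After `E` rounds, in each of which all of the `E` edges are relaxed, exactly the vertices with a
path to the target are marked. -/
theorem sweep_ne_zero_iff {z s : α} {E : ℕ} {V : Set α} (hs : ∀ i, src i ∈ V)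
    (hd : ∀ i, dst i ∈ V) (hz : z ∈ V) (hsrc : ∀ i, src (i % E) = src i)
    (hdst : ∀ i, dst (i % E) = dst i) (hE : 0 < E) {T : α → ℕ}
    (hT : ∀ s ∈ V, T s ≠ 0 ↔ s = z) (hsV : s ∈ V) :
    sweep src dst (E * E) T s ≠ 0 ↔ Reaches src dst z s := by
  refine ⟨reaches_of_sweep_ne_zero hs hd _ (fun s hsV h => ⟨0, (hT s hsV).1 h⟩) hsV, fun h => ?_⟩
  refine sweep_ne_zero_of_within hsrc hdst hE 0 E (fun s h => ?_) ?_ (z := z)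
  · have h : s = z := h
    exact (hT s (h ▸ hz)).2 h
  · rw [zero_add]
    exact h.within hsrc hE

end

end Relaxation

/-! ### Palindromic quotients as paths in a graph of carries -/

namespace PalindromicQuotient

/-- The leading digit is nonzero, and the symmetry carries it to the lowest place. -/
theorem digits_eq_one_cons {A : ℕ} (hA : IsPalindromic A) (h0 : A ≠ 0) :
    ∃ l, Nat.digits 2 A = 1 :: l := by
  have hpal : (Nat.digits 2 A).reverse = Nat.digits 2 A := hA
  have hlast := Nat.getLast_digit_ne_zero 2 h0
  rcases hd : Nat.digits 2 A with - | ⟨d, l⟩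
  · exact absurd hd (Nat.digits_ne_nil_iff_ne_zero.2 h0)
  · have h1 : (Nat.digits 2 A).getLast? = some d := by
      rw [← List.head?_reverse, hpal, hd, List.head?_cons]
    rw [List.getLast?_eq_some_getLast (Nat.digits_ne_nil_iff_ne_zero.2 h0)] at h1
    have h2 := Option.some.inj h1
    have h3 : d < 2 := Nat.digits_lt_base (by norm_num) (hd ▸ List.mem_cons_self)
    exact ⟨l, by congr; omega⟩

theorem odd_of_isPalindromic {A : ℕ} (hA : IsPalindromic A) (h0 : A ≠ 0) : A % 2 = 1 := by
  obtain ⟨l, hl⟩ := digits_eq_one_cons hA h0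
  rw [← Nat.ofDigits_digits 2 A, hl, Nat.ofDigits_cons]
  omega

theorem isPalindromicQuotient_iff {N : ℕ} :
    IsPalindromicQuotient N ↔
      ∃ A B : ℕ, IsPalindromic A ∧ IsPalindromic B ∧ B ≠ 0 ∧ N * B = A := by
  unfold IsPalindromicQuotient
  refine exists_congr fun A => exists_congr fun B => and_congr_right fun _ =>
    and_congr_right fun _ => and_congr_right fun hB => ?_
  rw [eq_div_iff (by exact_mod_cast hB)]
  exact_mod_cast Iff.rfl

theorem isPalindromicQuotient_zero : IsPalindromicQuotient 0 :=
  ⟨0, 1, by simp [IsPalindromic], by simp [IsPalindromic], by simp, by simp⟩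

theorem odd_of_isPalindromicQuotient {N : ℕ} (h : IsPalindromicQuotient N) (hN : N ≠ 0) :
    N % 2 = 1 := by
  obtain ⟨A, B, hA, -, hB, rfl⟩ := isPalindromicQuotient_iff.1 h
  have := odd_of_isPalindromic hA (Nat.mul_ne_zero hN hB)
  rw [Nat.mul_mod] at this
  rcases Nat.mod_two_eq_zero_or_one N with h | h
  · simp [h] at this
  · exact h

/-- From the carry `c` at the low end and the carry `h` at the high end, the digits `bs` of a
factor and `as` of `N` times this factor can be continued so that both carries vanish. Here
`W` is the power of two by which the leading digits of the product precede those of the factor. -/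
def Balanced (N W c : ℕ) (h : ℤ) (bs as : List ℕ) : Prop :=
  as.length = bs.length ∧ (∀ b ∈ bs, b < 2) ∧ (∀ a ∈ as, a < 2) ∧
    N * Nat.ofDigits 2 bs + c = Nat.ofDigits 2 as ∧
    2 ^ bs.length * h + W * (Nat.ofDigits 2 as.reverse : ℕ) = N * (Nat.ofDigits 2 bs.reverse : ℕ)

theorem balanced_nil_iff {N W c : ℕ} {h : ℤ} : Balanced N W c h [] [] ↔ c = 0 ∧ h = 0 := by
  simp [Balanced]

/-- One step of long multiplication at both ends: the low end forces the digit `a`, while at the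
high end the old carry is doubled and the new leading digits are accounted for. -/
theorem balanced_cons_iff {N W c a b : ℕ} {h : ℤ} {bs as : List ℕ} :
    Balanced N W c h (b :: bs) (a :: as) ↔
      b < 2 ∧ a = (N * b + c) % 2 ∧
        Balanced N W ((N * b + c) / 2) (2 * h + W * a - N * b) bs as := by
  unfold Balanced
  simp only [List.length_cons, List.mem_cons, forall_eq_or_imp, Nat.ofDigits_cons,
    Nat.ofDigits_reverse_cons, add_left_inj]
  constructor
  · rintro ⟨hl, ⟨hb, hbs⟩, ⟨ha, has⟩, h1, h2⟩
    have h3 : (N * b + c) + 2 * (N * Nat.ofDigits 2 bs) = a + 2 * Nat.ofDigits 2 as := by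
      linarith
    refine ⟨hb, by omega, hl, hbs, has, by omega, ?_⟩
    rw [hl] at h2
    push_cast at h2 ⊢
    rw [pow_succ] at h2
    linear_combination h2
  · rintro ⟨hb, ha, hl, hbs, has, h1, h2⟩
    refine ⟨hl, ⟨hb, hbs⟩, ⟨by omega, has⟩, ?_, ?_⟩
    · have h3 : (N * b + c) + 2 * (N * Nat.ofDigits 2 bs) = a + 2 * Nat.ofDigits 2 as := by
        omega
      rw [← h3]; ring
    · rw [hl]
      push_cast at h2 ⊢
      rw [pow_succ]
      linear_combination h2

theorem digits_ofDigits_mirror {l : List ℕ} (hl : ∀ d ∈ l, d < 2) (L : ℕ) :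
    Nat.digits 2 (Nat.ofDigits 2 (1 :: l ++ List.replicate L 0 ++ (1 :: l).reverse)) =
      1 :: l ++ List.replicate L 0 ++ (1 :: l).reverse := by
  refine Nat.digits_ofDigits 2 (by norm_num) _ (fun d hd => ?_) (fun _ => ?_)
  · simp only [List.mem_append, List.mem_cons, List.mem_reverse, List.mem_replicate] at hd
    rcases hd with ((rfl | hd) | ⟨-, rfl⟩) | (rfl | hd)
    · norm_num
    · exact hl d hd
    · norm_num
    · norm_num
    · exact hl d hd
  · simp

theorem isPalindromic_ofDigits {l : List ℕ} (hl : ∀ d ∈ l, d < 2) (L : ℕ) :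
    IsPalindromic (Nat.ofDigits 2 (1 :: l ++ List.replicate L 0 ++ (1 :: l).reverse)) := by
  unfold IsPalindromic
  rw [digits_ofDigits_mirror hl]
  simp

/-- A palindromic quotient is characterized by a pair of balanced digit strings. -/
theorem isPalindromicQuotient_iff_balanced {N : ℕ} (hN : N % 2 = 1) :
    IsPalindromicQuotient N ↔
      ∃ L : ℕ, 2 ^ L < 2 * N ∧ ∃ bs as, Balanced N (2 ^ L) (N / 2) (2 ^ L - N) bs as := by
  -- Both lists begin with `1`; for odd `N` this first step leads from zero carries to `N / 2` and
  -- `2 ^ L - N`.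
  have hstart : ∀ L bs as, Balanced N (2 ^ L) (N / 2) (2 ^ L - N) bs as ↔
      Balanced N (2 ^ L) 0 0 (1 :: bs) (1 :: as) := by
    intro L bs as
    rw [balanced_cons_iff]
    simp [hN]
  simp only [hstart]
  rw [isPalindromicQuotient_iff]
  constructor
  · rintro ⟨A, B, hA, hB, hB0, hAB⟩
    have hA0 : A ≠ 0 := by
      rw [← hAB]; exact Nat.mul_ne_zero (by omega) hB0
    obtain ⟨as, has⟩ := digits_eq_one_cons hA hA0
    obtain ⟨bs, hbs⟩ := digits_eq_one_cons hB hB0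
    have hle : (Nat.digits 2 B).length ≤ (Nat.digits 2 A).length :=
      Nat.le_length_digits_le 2 _ _ (by rw [← hAB]; exact Nat.le_mul_of_pos_left _ (by omega))
    obtain ⟨L, hL⟩ := Nat.exists_eq_add_of_le hle
    have hA1 : Nat.ofDigits 2 (Nat.digits 2 A) = A := Nat.ofDigits_digits 2 A
    have hB1 : Nat.ofDigits 2 (Nat.digits 2 B) = B := Nat.ofDigits_digits 2 B
    -- Padding `B` by zeros equalizes the lengths; reversal turns the padding into the factor `2 ^
    -- L`.
    refine ⟨L, ?_, bs ++ List.replicate L 0, as, ?_⟩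
    · have h1 : 2 ^ (Nat.digits 2 A).length ≤ 2 * A :=
        Nat.base_pow_length_digits_le 2 A (by norm_num) hA0
      have h2 : B < 2 ^ (Nat.digits 2 B).length := Nat.lt_base_pow_length_digits (by norm_num)
      rw [hL, pow_add, ← hAB] at h1
      have : 2 ^ (Nat.digits 2 B).length * 2 ^ L < 2 ^ (Nat.digits 2 B).length * (2 * N) := by
        have : N * B < N * 2 ^ (Nat.digits 2 B).length :=
          Nat.mul_lt_mul_of_pos_left h2 (by omega)
        calc _ ≤ _ := h1
          _ = 2 * (N * B) := by ring
          _ < 2 * (N * 2 ^ (Nat.digits 2 B).length) := by omega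
          _ = _ := by ring
      exact lt_of_mul_lt_mul_left this (Nat.zero_le _)
    · rw [← List.cons_append, ← hbs, ← has]
      refine ⟨by simp [hL], ?_, fun a ha => Nat.digits_lt_base (by norm_num) ha, ?_, ?_⟩
      · intro b hb
        rw [List.mem_append, List.mem_replicate] at hb
        rcases hb with hb | ⟨-, rfl⟩
        · exact Nat.digits_lt_base (by norm_num) hb
        · norm_num
      · rw [Nat.ofDigits_append_replicate_zero, hA1, hB1, hAB, add_zero]
      · have hA' : (Nat.digits 2 A).reverse = Nat.digits 2 A := hA
        have hB' : (Nat.digits 2 B).reverse = Nat.digits 2 B := hB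
        rw [List.reverse_append, hA', hB', hA1, List.reverse_replicate, Nat.ofDigits_append,
          Nat.ofDigits_replicate_zero, hB1, ← hAB, List.length_replicate]
        push_cast
        ring
  · rintro ⟨L, -, bs, as, hlen, hbs, has, h1, h2⟩
    -- The lists need not be palindromic themselves. In the mirrored numbers the low halves match by
    -- `h1` and the high halves by `h2`, with no carry between them.
    refine ⟨_, _, isPalindromic_ofDigits (fun d hd => has d (List.mem_cons_of_mem _ hd)) L,
      isPalindromic_ofDigits (fun d hd => hbs d (List.mem_cons_of_mem _ hd)) 0, ?_, ?_⟩
    · simp only [List.cons_append, Nat.ofDigits_cons]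
      omega
    · have h2' : 2 ^ L * Nat.ofDigits 2 (1 :: as).reverse
          = N * Nat.ofDigits 2 (1 :: bs).reverse := by
        simp only [mul_zero, zero_add] at h2
        exact_mod_cast h2
      simp only [List.replicate_zero, List.append_nil]
      rw [Nat.ofDigits_append, Nat.ofDigits_append, Nat.ofDigits_append, ← h1,
        Nat.ofDigits_replicate_zero, List.length_append, List.length_replicate, hlen, pow_add,
        mul_assoc _ (2 ^ L), h2']
      ring

end PalindromicQuotient

/-! ### The carry graph, with its vertices numbered by memory cells -/

namespace PalindromicQuotient

open Relaxation

/-- The cell for the carry `c` at the low end and the shifted carry `g` at the high end, in a table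
that begins at cell `p`. -/
def cell (N p c g : ℕ) : ℕ := c * (8 * N) + p + g

/-- The source of the edge number `i`. -/
def edgeSrc (N W p i : ℕ) : ℕ := cell N p (i / 2 / (N + W) % N) (i / 2 % (N + W))

/-- The cell that is reached from the carries `c` and `g` with the digit `b`. A value of the
second carry which is too small is truncated to `0`. -/
def succCell (N W p b c g : ℕ) : ℕ :=
  cell N p ((b * N + c) / 2) ((b * N + c) % 2 * W + g + g - (b * N + W))

/-- The target of the edge number `i`. -/
def edgeDst (N W p i : ℕ) : ℕ :=
  succCell N W p (i % 2) (i / 2 / (N + W) % N) (i / 2 % (N + W))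

/-- The number of edges. -/
def numEdges (N W : ℕ) : ℕ := (N + W) * N * 2

/-- A row has width `8 * N`. This suffices for edge targets, whose column is at most `2 * g` with `g
< N + W < 3 * N`. -/
theorem cell_inj {N p c g c' g' : ℕ} (hg : g < 8 * N) (hg' : g' < 8 * N)
    (h : cell N p c g = cell N p c' g') : c = c' ∧ g = g' := by
  unfold cell at h
  have h0 : 0 < 8 * N := by omega
  have h1 : g + (8 * N) * c = g' + (8 * N) * c' := by linarith
  constructor
  · have := congrArg (· / (8 * N)) h1
    simpa [Nat.add_mul_div_left _ _ h0, Nat.div_eq_of_lt hg, Nat.div_eq_of_lt hg'] using this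
  · have := congrArg (· % (8 * N)) h1
    simpa [Nat.mod_eq_of_lt hg, Nat.mod_eq_of_lt hg'] using this

theorem mod_numEdges_decode (N W i : ℕ) :
    i % numEdges N W % 2 = i % 2 ∧ i % numEdges N W / 2 % (N + W) = i / 2 % (N + W) ∧
      i % numEdges N W / 2 / (N + W) % N = i / 2 / (N + W) % N := by
  have h : numEdges N W = 2 * ((N + W) * N) := mul_comm _ _
  rw [h, Nat.mod_mul_right_div_self, Nat.mod_mul_right_div_self, Nat.mod_mod,
    Nat.mod_mul_right_mod, Nat.mod_mul_right_mod]
  exact ⟨rfl, rfl, rfl⟩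

theorem edgeSrc_mod (N W p i : ℕ) : edgeSrc N W p (i % numEdges N W) = edgeSrc N W p i := by
  obtain ⟨-, h2, h3⟩ := mod_numEdges_decode N W i
  rw [edgeSrc, h2, h3, edgeSrc]

theorem edgeDst_mod (N W p i : ℕ) : edgeDst N W p (i % numEdges N W) = edgeDst N W p i := by
  obtain ⟨h1, h2, h3⟩ := mod_numEdges_decode N W i
  rw [edgeDst, h1, h2, h3, edgeDst]

theorem exists_edge {N W p b c g : ℕ} (hb : b < 2) (hc : c < N) (hg : g < N + W) :
    ∃ i, edgeSrc N W p i = cell N p c g ∧ edgeDst N W p i = succCell N W p b c g := by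
  refine ⟨b + 2 * (g + (N + W) * c), ?_⟩
  have h1 : (b + 2 * (g + (N + W) * c)) / 2 = g + (N + W) * c := by omega
  have h2 : (g + (N + W) * c) / (N + W) = c := by
    rw [Nat.add_mul_div_left _ _ (by omega), Nat.div_eq_of_lt hg, zero_add]
  have h3 : (b + 2 * (g + (N + W) * c)) % 2 = b := by omega
  unfold edgeSrc edgeDst
  rw [h1, h2, h3, Nat.add_mul_mod_self_left, Nat.mod_eq_of_lt hg, Nat.mod_eq_of_lt hc]
  exact ⟨rfl, rfl⟩

/-- Truncation to column `0` is harmless: column `0` leads only to itself, and the target has column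
`W > 0`. Hence `0 < g` along the path, and every subtraction is exact. -/
theorem balanced_of_within {N W p : ℕ} (hW : 0 < W) (hWN : W < 2 * N) (k : ℕ) {c g : ℕ}
    (hg : g < 8 * N)
    (h : Within (edgeSrc N W p) (edgeDst N W p) (cell N p 0 W) k (cell N p c g)) :
    0 < g ∧ ∃ bs as, Balanced N W c ((g : ℤ) - W) bs as := by
  induction k generalizing c g with
  | zero =>
    obtain ⟨rfl, rfl⟩ := cell_inj hg (by omega) h
    exact ⟨hW, [], [], balanced_nil_iff.2 ⟨rfl, sub_self _⟩⟩
  | succ k ih =>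
    rcases h with h | ⟨i, hi, h⟩
    · exact ih hg h
    · have hlt : i / 2 % (N + W) < N + W := Nat.mod_lt _ (by omega)
      obtain ⟨hc, hg'⟩ := cell_inj (by omega) hg hi
      rw [edgeDst, hc, hg'] at h
      rw [hg'] at hlt
      have hb : i % 2 < 2 := Nat.mod_lt _ (by norm_num)
      generalize i % 2 = b at h hb
      have ha : (b * N + c) % 2 < 2 := Nat.mod_lt _ (by norm_num)
      have haW : (b * N + c) % 2 * W ≤ W := mul_le_of_le_one_left (Nat.zero_le _) (by omega)
      obtain ⟨h1, bs, as, h2⟩ := ih (by omega) h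
      refine ⟨by omega, b :: bs, (b * N + c) % 2 :: as, balanced_cons_iff.2 ⟨hb, ?_, ?_⟩⟩
      · rw [mul_comm N b]
      · rw [mul_comm N b]
        convert h2 using 1
        rw [Nat.cast_sub (by omega)]
        push_cast
        ring

/-- The bounds on `h` propagate backwards from the final carry `0`: from `2 * h = h' - W * a + N *
b` and `-W < h' < N` follows `-W < h < N`. So no balanced continuation leaves the table. -/
theorem reaches_of_balanced {N W p c : ℕ} {h : ℤ} {bs as : List ℕ} (hW : 0 < W) (hc : c < N)
    (hbal : Balanced N W c h bs as) :
    -W < h ∧ h < N ∧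
      Reaches (edgeSrc N W p) (edgeDst N W p) (cell N p 0 W) (cell N p c (h + W).toNat) := by
  induction bs generalizing c h as with
  | nil =>
    obtain rfl : as = [] := List.eq_nil_of_length_eq_zero hbal.1
    obtain ⟨rfl, rfl⟩ := balanced_nil_iff.1 hbal
    refine ⟨by omega, by omega, 0, ?_⟩
    simp [Within]
  | cons b bs ih =>
    rcases as with - | ⟨a, as⟩
    · exact absurd hbal.1 (by simp)
    · obtain ⟨hb, ha, hbal⟩ := balanced_cons_iff.1 hbal
      have hbN : N * b ≤ N := mul_le_of_le_one_right (Nat.zero_le _) (by omega)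
      have haW : W * a ≤ W := mul_le_of_le_one_right (Nat.zero_le _) (by omega)
      obtain ⟨h1, h2, h3⟩ := ih (by omega) hbal
      zify at hbN haW
      have hbN0 : (0 : ℤ) ≤ N * b := by positivity
      have haW0 : (0 : ℤ) ≤ W * a := by positivity
      have hl : -(W : ℤ) < h := by linarith
      have hr : h < N := by linarith
      refine ⟨hl, hr, ?_⟩
      obtain ⟨i, hi, hi'⟩ := exists_edge (p := p) (g := (h + W).toNat) (W := W) hb hc (by omega)
      rw [← hi]
      refine reaches_of_edge i ?_
      rw [hi', succCell, mul_comm b N, ← ha]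
      convert h3 using 2
      rw [mul_comm a W]
      have h4 : ((h + W).toNat : ℤ) = h + W := Int.toNat_of_nonneg (by omega)
      zify [show N * b + W ≤ W * a + (h + W).toNat + (h + W).toNat by
        zify; rw [h4]; linarith]
      rw [h4, Int.toNat_of_nonneg (by linarith)]
      ring

/-- The factor `W` leads to a representation of `N` as a palindromic quotient. -/
def Good (N W : ℕ) : Prop := ∃ bs as, Balanced N W (N / 2) (W - N) bs as

theorem reaches_iff_good {N W p : ℕ} (hW : 0 < W) (hWN : W < 2 * N) :
    Reaches (edgeSrc N W p) (edgeDst N W p) (cell N p 0 W) (cell N p (N / 2) (W + W - N)) ↔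
      Good N W := by
  constructor
  · rintro ⟨k, hk⟩
    obtain ⟨h1, h2⟩ := balanced_of_within hW hWN k (by omega) hk
    -- Positivity of the starting column, from `h1`, excludes truncation in `W + W - N`.
    rw [Nat.cast_sub (by omega)] at h2
    convert h2 using 2
    unfold Good
    congr! 5
    push_cast
    ring
  · rintro ⟨bs, as, h⟩
    obtain ⟨h1, -, h2⟩ := reaches_of_balanced (p := p) hW (by omega) h
    convert h2 using 2
    omega

theorem isPalindromicQuotient_iff_good {N : ℕ} :
    IsPalindromicQuotient N ↔ N = 0 ∨ N % 2 = 1 ∧ ∃ L : ℕ, 2 ^ L < 2 * N ∧ Good N (2 ^ L) := by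
  rcases eq_or_ne N 0 with rfl | hN
  · simp [isPalindromicQuotient_zero]
  · simp only [hN, false_or]
    constructor
    · intro h
      have hodd := odd_of_isPalindromicQuotient h hN
      exact ⟨hodd, by simpa [Good] using (isPalindromicQuotient_iff_balanced hodd).1 h⟩
    · rintro ⟨hodd, h⟩
      exact (isPalindromicQuotient_iff_balanced hodd).2 (by simpa [Good] using h)

/-- After the sweeps over the carry graph, the cells that reach the target are marked. -/
theorem sweep_cell_ne_zero_iff {N W p : ℕ} (hW : 0 < W) (hWN : W < 2 * N) {T : ℕ → ℕ}
    (hT : ∀ s, p ≤ s → (T s ≠ 0 ↔ s = cell N p 0 W)) :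
    sweep (edgeSrc N W p) (edgeDst N W p) (numEdges N W * numEdges N W) T
      (cell N p (N / 2) (W + W - N)) ≠ 0 ↔ Good N W := by
  have hcell : ∀ c g, cell N p c g ∈ Set.Ici p := fun c g => by
    simp only [cell, Set.mem_Ici]; omega
  rw [← reaches_iff_good (p := p) hW hWN]
  refine sweep_ne_zero_iff (src := edgeSrc N W p) (dst := edgeDst N W p) (V := Set.Ici p)
    (fun i => hcell _ _) (fun i => hcell _ _) (hcell _ _)
    (edgeSrc_mod N W p) (edgeDst_mod N W p) ?_ (fun s hs => hT s hs) (hcell _ _)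
  unfold numEdges
  have : 0 < N := by omega
  positivity

/-- The sweeps leave the cells behind the table unchanged. -/
theorem sweep_of_le {N W p s : ℕ} (hWN : W < 2 * N) (hs : p + N * (8 * N) ≤ s) (n : ℕ)
    (T : ℕ → ℕ) : sweep (edgeSrc N W p) (edgeDst N W p) n T s = T s := by
  refine sweep_of_forall_ne (fun i h => ?_) n T
  have h1 : i / 2 / (N + W) % N < N := Nat.mod_lt _ (by omega)
  have h2 : i / 2 % (N + W) < N + W := Nat.mod_lt _ (by omega)
  have h3 : (i / 2 / (N + W) % N + 1) * (8 * N) ≤ N * (8 * N) := Nat.mul_le_mul_right _ h1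
  rw [add_mul, one_mul] at h3
  unfold edgeSrc cell at h
  omega

end PalindromicQuotient

/-! ### Straight-line code on the random-access machine -/

namespace RAM

/-- The program leads from `c` to `c'` in at most `τ` steps, and until then all cells contain at
most `B`. -/
def Computes (P : Program) (B τ : ℕ) (c c' : Config) : Prop :=
  ∃ t ≤ τ, P.step^[t] c = c' ∧ ∀ s ≤ t, ∀ a, (P.step^[s] c).mem a ≤ B

theorem Computes.refl {P : Program} {B : ℕ} {c : Config} (h : ∀ a, c.mem a ≤ B) :
    Computes P B 0 c c :=
  ⟨0, le_rfl, rfl, fun s hs => by obtain rfl : s = 0 := by omega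
                                  exact h⟩

theorem Computes.trans {P : Program} {B τ τ' : ℕ} {c c' c'' : Config} (h : Computes P B τ c c')
    (h' : Computes P B τ' c' c'') : Computes P B (τ + τ') c c'' := by
  obtain ⟨t, ht, rfl, hb⟩ := h
  obtain ⟨t', ht', rfl, hb'⟩ := h'
  refine ⟨t' + t, by omega, Function.iterate_add_apply _ _ _ _, fun s hs a => ?_⟩
  rcases le_total s t with h | h
  · exact hb s h a
  · obtain ⟨r, rfl⟩ := Nat.exists_eq_add_of_le' h
    rw [Function.iterate_add_apply]
    exact hb' r (by omega) a

theorem Computes.mono {P : Program} {B B' τ τ' : ℕ} {c c' : Config} (h : Computes P B τ c c')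
    (hB : B ≤ B') (hτ : τ ≤ τ') : Computes P B' τ' c c' := by
  obtain ⟨t, ht, h1, h2⟩ := h
  exact ⟨t, ht.trans hτ, h1, fun s hs a => (h2 s hs a).trans hB⟩

theorem Computes.step {P : Program} {B : ℕ} {c c' : Config} {i : Instr} (hi : P[c.pc]? = some i)
    (h : i.exec c = c') (hb : ∀ a, c.mem a ≤ B) (hb' : ∀ a, c'.mem a ≤ B) :
    Computes P B 1 c c' := by
  have hs : P.step c = c' := by rw [Program.step, hi, ← h]
  refine ⟨1, le_rfl, hs, fun s hs' a => ?_⟩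
  rcases (by omega : s = 0 ∨ s = 1) with rfl | rfl
  · exact hb a
  · rw [Function.iterate_one, hs]
    exact hb' a

/-- The memory is split into registers, the contents of the first cells, and a table. -/
abbrev Store := List ℕ × (ℕ → ℕ)

/-- The content of the cells. -/
def Store.mem (σ : Store) : ℕ → ℕ :=
  fun a => if a < σ.1.length then σ.1.getD a 0 else σ.2 a

/-- The effect of an instruction that addresses registers directly and the table indirectly. -/
def Instr.act : Instr → Store → Store
  | .const d v, σ => (σ.1.set d v, σ.2)
  | .arith o d a b, σ => (σ.1.set d (o.eval (σ.1.getD a 0) (σ.1.getD b 0)), σ.2)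
  | .load d a, σ => (σ.1.set d (σ.2 (σ.1.getD a 0)), σ.2)
  | .store a s, σ => (σ.1, Function.update σ.2 (σ.1.getD a 0) (σ.1.getD s 0))
  | .jump _, σ => σ
  | .jumpIfZero _ _, σ => σ

/-- The instruction is no jump, addresses registers directly, and the table indirectly. -/
def Instr.Admissible : Instr → Store → Prop
  | .const d _, σ => d < σ.1.length
  | .arith _ d a b, σ => d < σ.1.length ∧ a < σ.1.length ∧ b < σ.1.length
  | .load d a, σ => d < σ.1.length ∧ a < σ.1.length ∧ σ.1.length ≤ σ.1.getD a 0
  | .store a s, σ => a < σ.1.length ∧ s < σ.1.length ∧ σ.1.length ≤ σ.1.getD a 0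
  | .jump _, _ => False
  | .jumpIfZero _ _, _ => False

/-- The constant that occurs in an instruction. -/
def Instr.constant : Instr → ℕ
  | .const _ v => v
  | _ => 0

/-- The effect of straight-line code. -/
def actAll : List Instr → Store → Store
  | [], σ => σ
  | i :: is, σ => actAll is (i.act σ)

/-- All instructions of straight-line code are admissible. -/
def AdmissibleAll : List Instr → Store → Prop
  | [], _ => True
  | i :: is, σ => i.Admissible σ ∧ AdmissibleAll is (i.act σ)

theorem actAll_append (is js : List Instr) (σ : Store) :
    actAll (is ++ js) σ = actAll js (actAll is σ) := by
  induction is generalizing σ with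
  | nil => rfl
  | cons i is ih => exact ih _

theorem admissibleAll_append (is js : List Instr) (σ : Store) :
    AdmissibleAll (is ++ js) σ ↔ AdmissibleAll is σ ∧ AdmissibleAll js (actAll is σ) := by
  induction is generalizing σ with
  | nil => exact (and_iff_right trivial).symm
  | cons i is ih =>
    rw [List.cons_append, AdmissibleAll, AdmissibleAll, ih, and_assoc]
    rfl

theorem Store.mem_set {l : List ℕ} {T : ℕ → ℕ} {d v : ℕ} (hd : d < l.length) :
    Store.mem (l.set d v, T) = Function.update (Store.mem (l, T)) d v := by
  funext a
  unfold Store.mem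
  rcases eq_or_ne a d with rfl | h
  · simp [hd]
  · simp [Function.update_of_ne h, List.getD_eq_getElem?_getD, List.getElem?_set_ne h.symm]

theorem Store.mem_update {l : List ℕ} {T : ℕ → ℕ} {d v : ℕ} (hd : l.length ≤ d) :
    Store.mem (l, Function.update T d v) = Function.update (Store.mem (l, T)) d v := by
  funext a
  unfold Store.mem
  rcases eq_or_ne a d with rfl | h
  · simp [hd.not_gt]
  · simp [Function.update_of_ne h]

theorem Store.mem_of_lt {σ : Store} {a : ℕ} (h : a < σ.1.length) : σ.mem a = σ.1.getD a 0 :=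
  if_pos h

theorem Store.mem_of_le {σ : Store} {a : ℕ} (h : σ.1.length ≤ a) : σ.mem a = σ.2 a :=
  if_neg h.not_gt

theorem Store.mem_le {l : List ℕ} {T : ℕ → ℕ} {X : ℕ} (hl : ∀ y ∈ l, y ≤ X) (hT : ∀ a, T a ≤ X)
    (a : ℕ) : Store.mem (l, T) a ≤ X := by
  unfold Store.mem
  split
  · rename_i h
    rw [List.getD_eq_getElem _ _ h]
    exact hl _ (List.getElem_mem h)
  · exact hT a

theorem Instr.exec_mem {i : Instr} {σ : Store} (h : i.Admissible σ) (pc : ℕ) :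
    i.exec ⟨pc, σ.mem⟩ = ⟨pc + 1, (i.act σ).mem⟩ := by
  obtain ⟨l, T⟩ := σ
  cases i with
  | const d v => simp only [exec, act, Store.mem_set h]
  | arith o d a b =>
    simp only [exec, act, Store.mem_set h.1]
    rw [Store.mem_of_lt h.2.1, Store.mem_of_lt h.2.2]
  | load d a =>
    simp only [exec, act, Store.mem_set h.1]
    rw [Store.mem_of_lt h.2.1, Store.mem_of_le h.2.2]
  | store a s =>
    simp only [exec, act, Store.mem_update h.2.2]
    rw [Store.mem_of_lt h.1, Store.mem_of_lt h.2.1]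
  | jump t => exact h.elim
  | jumpIfZero a t => exact h.elim

theorem Op.eval_le {o : Op} {x y X : ℕ} (hX : 2 ≤ X) (hx : x ≤ X) (hy : y ≤ X) :
    o.eval x y ≤ X * X := by
  have h1 : X * 2 ≤ X * X := Nat.mul_le_mul_left X hX
  cases o with
  | add => simp only [eval]; omega
  | sub => simp only [eval]; omega
  | mul => exact Nat.mul_le_mul hx hy
  | div => exact (Nat.div_le_self _ _).trans (by omega)

theorem Instr.exec_mem_le {i : Instr} {c : Config} {X : ℕ} (hX : 2 ≤ X) (hi : i.constant ≤ X)
    (hc : ∀ a, c.mem a ≤ X) (a : ℕ) : (i.exec c).mem a ≤ X * X := by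
  have hXX : X ≤ X * X := Nat.le_mul_self X
  have key : ∀ d v, v ≤ X * X → Function.update c.mem d v a ≤ X * X := fun d v hv => by
    rcases eq_or_ne a d with rfl | h
    · simpa using hv
    · simpa [Function.update_of_ne h] using (hc a).trans hXX
  cases i with
  | const d v => exact key _ _ (le_trans hi hXX)
  | arith o d x y => exact key _ _ (Op.eval_le hX (hc x) (hc y))
  | load d x => exact key _ _ ((hc _).trans hXX)
  | store x s => exact key _ _ ((hc _).trans hXX)
  | jump t => exact (hc a).trans hXX
  | jumpIfZero x t => exact (hc a).trans hXX

/-- The execution of straight-line code. -/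
theorem Computes.straightLine {P : Program} {is rest : List Instr} {off X : ℕ} {σ : Store}
    (hP : P.drop off = is ++ rest) (hadm : AdmissibleAll is σ) (hX : 2 ≤ X)
    (hconst : ∀ i ∈ is, i.constant ≤ X) (hσ : ∀ a, σ.mem a ≤ X) :
    Computes P (X ^ 2 ^ is.length) is.length ⟨off, σ.mem⟩
      ⟨off + is.length, (actAll is σ).mem⟩ := by
  induction is generalizing off X σ with
  | nil => exact .refl (by simpa using hσ)
  | cons i is ih =>
    have hXX : X ≤ X * X := Nat.le_mul_self X
    have hstep : P[off]? = some i := by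
      have := congrArg (fun l => l[0]?) hP
      simpa using this
    have hdrop : P.drop (off + 1) = is ++ rest := by
      rw [← List.drop_drop, hP]
      rfl
    have hle := Instr.exec_mem_le (c := ⟨off, σ.mem⟩) hX (hconst i (by simp)) hσ
    have hexec := Instr.exec_mem hadm.1 off
    rw [hexec] at hle
    have h2 := ih hdrop hadm.2 (hX.trans hXX)
      (fun j hj => (hconst j (List.mem_cons_of_mem _ hj)).trans hXX) hle
    -- Each instruction at most squares the bound, which doubles the exponent.
    have hpow : X ^ 2 ^ (is.length + 1) = (X * X) ^ 2 ^ is.length := by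
      rw [pow_succ', pow_mul, sq]
    have hpos : X * X ≤ (X * X) ^ 2 ^ is.length :=
      Nat.le_self_pow (by positivity) _
    have h1 : Computes P (X ^ 2 ^ (is.length + 1)) 1 ⟨off, σ.mem⟩ ⟨off + 1, (i.act σ).mem⟩ := by
      rw [hpow]
      exact .step hstep hexec (fun a => (hσ a).trans (hXX.trans hpos))
        (fun a => (hle a).trans hpos)
    have h3 := h1.trans (h2.mono hpow.ge le_rfl)
    rw [List.length_cons, add_comm is.length 1, ← add_assoc off, add_comm 1 is.length]
    simpa [actAll, add_comm] using h3

/-- A halted configuration is a fixed point of `step`, so it persists at all later times. -/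
theorem Computes.halted {P : Program} {N B τ : ℕ} {c : Config} (h : Computes P B τ (start N) c)
    (hc : P.Halted c) : P.configAt N τ = c ∧ ∀ t a, (P.configAt N t).mem a ≤ B := by
  obtain ⟨t, ht, h1, h2⟩ := h
  have hfix : P.step c = c := by
    rw [Program.step, List.getElem?_eq_none hc]
  have hlate : ∀ s, t ≤ s → P.configAt N s = c := fun s hs => by
    obtain ⟨r, rfl⟩ := Nat.exists_eq_add_of_le' hs
    rw [Program.configAt, Function.iterate_add_apply, h1, Function.iterate_fixed hfix]
  refine ⟨hlate τ ht, fun s a => ?_⟩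
  rcases le_total s t with hs | hs
  · exact h2 s hs a
  · rw [hlate s hs, ← h1]
    exact h2 t le_rfl a

end RAM

/-! ### The program -/

namespace PalindromicQuotient

open RAM Relaxation

/-- Initialization of the constants and of the loop over the powers of two. -/
def initCode : List Instr :=
  [.const 1 1, .const 2 2, .const 3 1, .const 10 8, .arith .mul 8 10 0, .arith .add 4 0 0,
    .arith .sub 4 4 3, .const 10 0]

/-- Preparation of a table with a mark at the target. -/
def tableCode : List Instr :=
  [.arith .add 7 0 3, .arith .mul 10 3 0, .arith .mul 10 10 8, .const 9 20, .arith .add 9 9 10,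
    .arith .add 17 9 3, .store 17 1, .arith .mul 10 7 0, .arith .mul 10 10 2,
    .arith .mul 6 10 10, .const 10 0, .const 17 0]

/-- Decoding of the edge number. -/
def decodeCode : List Instr :=
  [.arith .sub 6 6 1, .arith .div 12 6 2, .arith .mul 10 12 2, .arith .sub 11 6 10,
    .arith .div 15 12 7, .arith .mul 10 15 7, .arith .sub 13 12 10,
    .arith .div 10 15 0, .arith .mul 10 10 0, .arith .sub 14 15 10]

/-- Reading the mark of the target of an edge. -/
def readCode : List Instr :=
  [.arith .mul 11 11 0, .arith .add 16 11 14, .arith .div 15 16 2, .arith .mul 10 15 2,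
    .arith .sub 10 16 10, .arith .mul 10 10 3, .arith .add 10 10 13, .arith .add 10 10 13,
    .arith .add 11 11 3, .arith .sub 10 10 11,
    .arith .mul 17 15 8, .arith .add 17 17 9, .arith .add 17 17 10, .load 18 17]

/-- Updating the mark of the source of an edge, and clearing the auxiliary registers. -/
def markCode : List Instr :=
  [.arith .mul 17 14 8, .arith .add 17 17 9, .arith .add 17 17 13, .load 19 17,
    .arith .add 18 18 19, .arith .sub 18 1 18, .arith .sub 18 1 18, .store 17 18,
    .const 10 0, .const 11 0, .const 12 0, .const 13 0, .const 14 0, .const 15 0, .const 16 0,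
    .const 17 0, .const 18 0, .const 19 0]

/-- Relaxation of an edge. -/
def relaxCode : List Instr := decodeCode ++ (readCode ++ markCode)

/-- Inspection of the table, and transition to the next power of two. -/
def inspectCode : List Instr :=
  [.arith .div 10 0 2, .arith .mul 10 10 8, .arith .add 10 10 9, .arith .add 11 3 3,
    .arith .sub 11 11 0, .arith .add 10 10 11, .load 18 10, .arith .add 5 5 18,
    .arith .sub 5 1 5, .arith .sub 5 1 5, .arith .add 3 3 3, .arith .add 4 0 0,
    .arith .sub 4 4 3, .const 7 0, .const 9 0, .const 10 0, .const 11 0, .const 18 0]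

/-- Computation of the output. -/
def outputCode : List Instr :=
  [.arith .div 10 0 2, .arith .mul 10 10 2, .arith .sub 10 0 10, .arith .mul 5 5 10,
    .arith .sub 10 1 0, .arith .add 0 5 10]

/-- The program that recognizes palindromic quotients. -/
def program : Program :=
  initCode ++ .jumpIfZero 4 84 :: tableCode ++ .jumpIfZero 6 65 :: relaxCode ++
    .jump 21 :: inspectCode ++ .jump 8 :: outputCode

/-- The registers between the blocks of the program. -/
def regs (N W x f i g p : ℕ) : List ℕ :=
  [N, 1, 2, W, x, f, i, g, 8 * N, p, 0, 0, 0, 0, 0, 0, 0, 0, 0, 0]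

theorem mem_le {N W x f i g p X : ℕ} {T : ℕ → ℕ} (h2 : 2 ≤ X) (hN : 8 * N ≤ X) (hW : W ≤ X)
    (hx : x ≤ X) (hf : f ≤ 1) (hi : i ≤ X) (hg : g ≤ X) (hp : p ≤ X) (hT : ∀ a, T a ≤ 1) (a : ℕ) :
    Store.mem (regs N W x f i g p, T) a ≤ X := by
  refine Store.mem_le (fun y hy => ?_) (fun a => (hT a).trans (by omega)) a
  simp only [regs, List.mem_cons, List.not_mem_nil, or_false] at hy
  rcases hy with h | h | h | h | h | h | h | h | h | h | h | h | h | h | h | h | h | h | h | h <;>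
    omega

theorem actAll_initCode (N : ℕ) (T : ℕ → ℕ) :
    actAll initCode (N :: List.replicate 19 0, T) = (regs N 1 (N + N - 1) 0 0 0 0, T) := rfl

/-- The table start grows with `W` by at least one table size per doubling. Each table therefore
lies in fresh zero memory and nothing has to be erased. -/
theorem actAll_tableCode (N W x f : ℕ) (T : ℕ → ℕ) :
    actAll tableCode (regs N W x f 0 0 0, T) =
      (regs N W x f (numEdges N W * numEdges N W) (N + W) (20 + W * N * (8 * N)),
        Function.update T (20 + W * N * (8 * N) + W) 1) := rfl

/-- Remainders are computed as `x - x / m * m`. The witness `t` is a scratch value that is never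
used again. -/
theorem actAll_decodeCode (N W x f i p : ℕ) (T : ℕ → ℕ) :
    ∃ t, actAll decodeCode (regs N W x f (i + 1) (N + W) p, T) =
      ([N, 1, 2, W, x, f, i, N + W, 8 * N, p, t, i % 2, i / 2, i / 2 % (N + W),
        i / 2 / (N + W) % N, i / 2 / (N + W), 0, 0, 0, 0], T) := by
  simp only [Nat.mod_eq_sub_div_mul]
  exact ⟨_, rfl⟩

theorem actAll_readCode (N W x f i p t b j g c q : ℕ) (T : ℕ → ℕ) :
    ∃ t₁ t₂ t₃ t₄ t₅, actAll readCode
        ([N, 1, 2, W, x, f, i, N + W, 8 * N, p, t, b, j, g, c, q, 0, 0, 0, 0], T) =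
      ([N, 1, 2, W, x, f, i, N + W, 8 * N, p, t₁, t₂, j, g, c, t₃, t₄, t₅,
        T (succCell N W p b c g), 0], T) := by
  simp only [succCell, cell, Nat.mod_eq_sub_div_mul, actAll, readCode, Instr.act, Op.eval,
    List.set_cons_succ, List.set_cons_zero,
    List.getD_cons_succ, List.getD_cons_zero]
  exact ⟨_, _, _, _, _, rfl⟩

theorem actAll_markCode (N W x f i p t b j g c q d u v : ℕ) (T : ℕ → ℕ) :
    actAll markCode
        ([N, 1, 2, W, x, f, i, N + W, 8 * N, p, t, b, j, g, c, q, d, u, v, 0], T) =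
      (regs N W x f i (N + W) p,
        Function.update T (cell N p c g) (1 - (1 - (v + T (cell N p c g))))) := by
  simp only [cell, regs, actAll, markCode, Instr.act, Op.eval, List.set_cons_succ, List.set_cons_zero,
    List.getD_cons_succ, List.getD_cons_zero]

theorem actAll_relaxCode (N W x f i p : ℕ) (T : ℕ → ℕ) :
    actAll relaxCode (regs N W x f (i + 1) (N + W) p, T) =
      (regs N W x f i (N + W) p, relax (edgeSrc N W p) (edgeDst N W p) T i) := by
  obtain ⟨t, ht⟩ := actAll_decodeCode N W x f i p T
  obtain ⟨t₁, t₂, t₃, t₄, t₅, h⟩ := actAll_readCode N W x f i p t (i % 2) (i / 2)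
    (i / 2 % (N + W)) (i / 2 / (N + W) % N) (i / 2 / (N + W)) T
  rw [relaxCode, actAll_append, actAll_append, ht, h, actAll_markCode, relax, edgeSrc, edgeDst]

theorem actAll_inspectCode (N W x f p : ℕ) (T : ℕ → ℕ) :
    actAll inspectCode (regs N W x f 0 (N + W) p, T) =
      (regs N (W + W) (N + N - (W + W)) (1 - (1 - (f + T (cell N p (N / 2) (W + W - N))))) 0 0 0,
        T) := by
  simp only [cell, regs, actAll, inspectCode, Instr.act, Op.eval, List.set_cons_succ, List.set_cons_zero,
    List.getD_cons_succ, List.getD_cons_zero]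

theorem admissibleAll_initCode (N : ℕ) (T : ℕ → ℕ) :
    AdmissibleAll initCode (N :: List.replicate 19 0, T) := by
  simp [AdmissibleAll, initCode, Instr.Admissible, Instr.act]

theorem admissibleAll_tableCode (N W x f : ℕ) (T : ℕ → ℕ) :
    AdmissibleAll tableCode (regs N W x f 0 0 0, T) := by
  simp [AdmissibleAll, tableCode, Instr.Admissible, Instr.act, regs, Op.eval]
  omega

theorem admissibleAll_relaxCode (N W x f i p : ℕ) (T : ℕ → ℕ) (hp : 20 ≤ p) :
    AdmissibleAll relaxCode (regs N W x f (i + 1) (N + W) p, T) := by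
  obtain ⟨t, ht⟩ := actAll_decodeCode N W x f i p T
  obtain ⟨t₁, t₂, t₃, t₄, t₅, h⟩ := actAll_readCode N W x f i p t (i % 2) (i / 2)
    (i / 2 % (N + W)) (i / 2 / (N + W) % N) (i / 2 / (N + W)) T
  rw [relaxCode, admissibleAll_append, admissibleAll_append, ht, h]
  refine ⟨?_, ?_, ?_⟩
  · simp [AdmissibleAll, decodeCode, Instr.Admissible, Instr.act, regs]
  · simp [AdmissibleAll, readCode, Instr.Admissible, Instr.act, Op.eval]
    omega
  · simp [AdmissibleAll, markCode, Instr.Admissible, Instr.act, Op.eval]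
    omega

theorem admissibleAll_inspectCode (N W x f g p : ℕ) (T : ℕ → ℕ) (hp : 20 ≤ p) :
    AdmissibleAll inspectCode (regs N W x f 0 g p, T) := by
  simp [AdmissibleAll, inspectCode, Instr.Admissible, Instr.act, regs, Op.eval]
  omega

theorem admissibleAll_outputCode (N W x f : ℕ) (T : ℕ → ℕ) :
    AdmissibleAll outputCode (regs N W x f 0 0 0, T) := by
  simp [AdmissibleAll, outputCode, Instr.Admissible, Instr.act, regs, Op.eval]

end PalindromicQuotient

/-! ### Correctness and running time of the program -/

namespace PalindromicQuotient

open RAM Relaxation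

/-- The crude length bound `64` gives all blocks the same exponent `2 ^ 64`. -/
theorem computes_code {is rest : List Instr} {off X : ℕ} {σ : Store}
    (hP : program.drop off = is ++ rest) (hlen : is.length ≤ 64) (hadm : AdmissibleAll is σ)
    (hX : 20 ≤ X) (hconst : ∀ i ∈ is, i.constant ≤ 20) (hσ : ∀ a, σ.mem a ≤ X) :
    Computes program (X ^ 2 ^ 64) is.length ⟨off, σ.mem⟩
      ⟨off + is.length, (actAll is σ).mem⟩ :=
  (Computes.straightLine hP hadm (by omega) (fun i hi => (hconst i hi).trans hX) hσ).mono
    (Nat.pow_le_pow_right (by omega) (Nat.pow_le_pow_right (by norm_num) hlen)) le_rfl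

theorem computes_jump {c : Config} {t X : ℕ} (h : program[c.pc]? = some (.jump t))
    (hc : ∀ a, c.mem a ≤ X) : Computes program (X ^ 2 ^ 64) 1 c ⟨t, c.mem⟩ := by
  have hle : X ≤ X ^ 2 ^ 64 := Nat.le_self_pow (by positivity) _
  exact .step h rfl (fun a => (hc a).trans hle) (fun a => (hc a).trans hle)

theorem computes_jumpIfZero_of_eq {c : Config} {a t X : ℕ} (h0 : c.mem a = 0)
    (h : program[c.pc]? = some (.jumpIfZero a t)) (hc : ∀ a, c.mem a ≤ X) :
    Computes program (X ^ 2 ^ 64) 1 c ⟨t, c.mem⟩ := by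
  have hle : X ≤ X ^ 2 ^ 64 := Nat.le_self_pow (by positivity) _
  exact .step h (by rw [Instr.exec, if_pos h0]) (fun a => (hc a).trans hle)
    (fun a => (hc a).trans hle)

theorem computes_jumpIfZero_of_ne {c : Config} {a t X : ℕ} (h0 : c.mem a ≠ 0)
    (h : program[c.pc]? = some (.jumpIfZero a t)) (hc : ∀ a, c.mem a ≤ X) :
    Computes program (X ^ 2 ^ 64) 1 c ⟨c.pc + 1, c.mem⟩ := by
  have hle : X ≤ X ^ 2 ^ 64 := Nat.le_self_pow (by positivity) _
  exact .step h (by rw [Instr.exec, if_neg h0]) (fun a => (hc a).trans hle)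
    (fun a => (hc a).trans hle)

/-- The loop over the edges. -/
theorem computes_sweep {N W x f p X : ℕ} (hX : 20 ≤ X) (hN : 8 * N ≤ X) (hW : W ≤ X)
    (hx : x ≤ X) (hf : f ≤ 1) (hg : N + W ≤ X) (hp : p ≤ X) (hp' : 20 ≤ p) (n : ℕ) (hn : n ≤ X)
    {T : ℕ → ℕ} (hT : ∀ a, T a ≤ 1) :
    Computes program (X ^ 2 ^ 64) (n * 44 + 1) ⟨21, Store.mem (regs N W x f n (N + W) p, T)⟩
      ⟨65, Store.mem (regs N W x f 0 (N + W) p,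
        sweep (edgeSrc N W p) (edgeDst N W p) n T)⟩ := by
  induction n generalizing T with
  | zero =>
    exact (computes_jumpIfZero_of_eq (c := ⟨21, Store.mem (regs N W x f 0 (N + W) p, T)⟩)
      (X := X) (a := 6) rfl rfl (mem_le (by omega) hN hW hx hf hn hg hp hT)).mono le_rfl (by omega)
  | succ n ih =>
    have h1 := computes_jumpIfZero_of_ne
      (c := ⟨21, Store.mem (regs N W x f (n + 1) (N + W) p, T)⟩)
      (X := X) (a := 6) (t := 65) (Nat.succ_ne_zero n) rfl (mem_le (by omega) hN hW hx hf hn hg hp hT)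
    have h2 := computes_code (is := relaxCode) (off := 22) rfl (by decide)
      (admissibleAll_relaxCode N W x f n p T hp') hX (by decide)
      (mem_le (by omega) hN hW hx hf hn hg hp hT)
    rw [actAll_relaxCode] at h2
    have h3 := computes_jump (c := ⟨64, Store.mem (regs N W x f n (N + W) p,
      relax (edgeSrc N W p) (edgeDst N W p) T n)⟩) (X := X) (t := 21) rfl
      (mem_le (by omega) hN hW hx hf (by omega) hg hp (relax_le_one hT n))
    have h4 := ih (by omega)
      (relax_le_one (src := edgeSrc N W p) (dst := edgeDst N W p) hT n)
    have hlen : relaxCode.length = 42 := rfl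
    rw [hlen] at h2
    -- One pass costs a test, 42 instructions and a jump, hence 44 steps.
    refine (h1.trans (h2.trans (h3.trans h4))).mono le_rfl (by omega)

/-- A bound for the contents of the cells between the blocks of the program. -/
theorem size_bounds (N W : ℕ) (hW : W < 2 * N) :
    20 + W * N * (8 * N) ≤ (N + 2) ^ 10 ∧
      numEdges N W * numEdges N W ≤ 36 * N ^ 4 ∧ 36 * N ^ 4 ≤ (N + 2) ^ 10 := by
  have hpow : ∀ k, 2 ^ k ≤ (N + 2) ^ k := fun k => Nat.pow_le_pow_left (by omega) k
  refine ⟨?_, ?_, ?_⟩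
  · have h1 : W * N * (8 * N) ≤ 2 * N * N * (8 * N) := by gcongr
    have h2 : N ^ 3 ≤ (N + 2) ^ 3 := Nat.pow_le_pow_left (by omega) 3
    calc 20 + W * N * (8 * N) ≤ 20 + 16 * N ^ 3 := by linarith
      _ ≤ 2 ^ 7 * (N + 2) ^ 3 := by
        have := hpow 3
        omega
      _ ≤ (N + 2) ^ 7 * (N + 2) ^ 3 := by gcongr; omega
      _ = (N + 2) ^ 10 := by ring
  · have h : numEdges N W ≤ 6 * N ^ 2 := by
      unfold numEdges
      calc (N + W) * N * 2 ≤ (3 * N) * N * 2 := by gcongr; omega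
        _ = 6 * N ^ 2 := by ring
    calc numEdges N W * numEdges N W ≤ 6 * N ^ 2 * (6 * N ^ 2) := Nat.mul_le_mul h h
      _ = 36 * N ^ 4 := by ring
  · calc 36 * N ^ 4 ≤ (N + 2) ^ 6 * (N + 2) ^ 4 := by
          gcongr
          · have := hpow 6
            omega
          · omega
      _ = (N + 2) ^ 10 := by ring

/-- The loop over the powers of two. -/
theorem computes_search {N : ℕ} (k : ℕ) {W f : ℕ} {T : ℕ → ℕ} (hk : 2 * N ≤ W * 2 ^ k)
    (hW : 0 < W) (hWN : W ≤ 4 * N + 1) (hf : f ≤ 1) (hT : ∀ a, T a ≤ 1)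
    (hT0 : ∀ a, 20 + W * N * (8 * N) ≤ a → T a = 0) :
    ∃ W' f' T', W' ≤ 4 * N + 1 ∧ f' ≤ 1 ∧ (∀ a, T' a ≤ 1) ∧
      (f' ≠ 0 ↔ f ≠ 0 ∨ ∃ L, W * 2 ^ L < 2 * N ∧ Good N (W * 2 ^ L)) ∧
      Computes program (((N + 2) ^ 10) ^ 2 ^ 64) (k * (1584 * N ^ 4 + 33) + 1)
        ⟨8, Store.mem (regs N W (N + N - W) f 0 0 0, T)⟩
        ⟨84, Store.mem (regs N W' 0 f' 0 0 0, T')⟩ := by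
  have hX : (N + 2) * 2 ^ 9 ≤ (N + 2) ^ 10 := by
    rw [pow_succ' (N + 2) 9]
    gcongr
    omega
  induction k generalizing W f T with
  | zero =>
    have hx : N + N - W = 0 := by omega
    refine ⟨W, f, T, hWN, hf, hT, ?_, ?_⟩
    · refine ⟨Or.inl, ?_⟩
      rintro (h | ⟨L, h, -⟩)
      · exact h
      · have : W ≤ W * 2 ^ L := Nat.le_mul_of_pos_right _ (by positivity)
        omega
    · rw [hx]
      exact (computes_jumpIfZero_of_eq (c := ⟨8, Store.mem (regs N W 0 f 0 0 0, T)⟩)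
        (X := (N + 2) ^ 10) (a := 4) rfl rfl (mem_le (by omega) (by omega) (by omega) (by omega) hf
        (by omega) (by omega) (by omega) hT)).mono le_rfl (by omega)
  | succ k ih =>
    by_cases hWN' : W < 2 * N
    · obtain ⟨hp, hE, hE'⟩ := size_bounds N W hWN'
      have h1 := computes_jumpIfZero_of_ne
        (c := ⟨8, Store.mem (regs N W (N + N - W) f 0 0 0, T)⟩)
        (X := (N + 2) ^ 10) (a := 4) (t := 84) (show N + N - W ≠ 0 by omega) rfl
        (mem_le (by omega) (by omega) (by omega)
          (by omega) hf (by omega) (by omega) (by omega) hT)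
      have h2 := computes_code (is := tableCode) (off := 9) rfl (by decide)
        (admissibleAll_tableCode N W (N + N - W) f T) (X := (N + 2) ^ 10) (by omega) (by decide)
        (mem_le (by omega) (by omega) (by omega)
          (by omega) hf (by omega) (by omega) (by omega) hT)
      rw [actAll_tableCode] at h2
      set p := 20 + W * N * (8 * N) with hpdef
      set T₁ := Function.update T (p + W) 1 with hT₁
      have hT₁le : ∀ a, T₁ a ≤ 1 := fun a => by
        rcases eq_or_ne a (p + W) with rfl | h
        · simp [hT₁]
        · simpa [hT₁, Function.update_of_ne h] using hT a
      have h3 := computes_sweep (N := N) (W := W) (x := N + N - W) (f := f) (p := p)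
        (X := (N + 2) ^ 10) (by omega) (by omega) (by omega) (by omega) hf (by omega) hp
        (by omega) (numEdges N W * numEdges N W) (hE.trans hE') hT₁le
      set T₂ := sweep (edgeSrc N W p) (edgeDst N W p) (numEdges N W * numEdges N W) T₁ with hT₂
      have hT₂le : ∀ a, T₂ a ≤ 1 := sweep_le_one _ hT₁le
      have h4 := computes_code (is := inspectCode) (off := 65) rfl (by decide)
        (admissibleAll_inspectCode N W (N + N - W) f (N + W) p T₂ (by omega))
        (X := (N + 2) ^ 10) (by omega) (by decide)
        (mem_le (by omega) (by omega) (by omega) (by omega) hf (by omega) (by omega) hp hT₂le)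
      rw [actAll_inspectCode] at h4
      have hgood : T₂ (cell N p (N / 2) (W + W - N)) ≠ 0 ↔ Good N W := by
        refine sweep_cell_ne_zero_iff hW hWN' fun s hs => ?_
        have hc : cell N p 0 W = p + W := by simp [cell]
        rw [hc]
        rcases eq_or_ne s (p + W) with rfl | h
        · simp [hT₁]
        · simp [hT₁, hT0 s hs, h]
      set f₂ := 1 - (1 - (f + T₂ (cell N p (N / 2) (W + W - N)))) with hf₂
      have hf₂le : f₂ ≤ 1 := by omega
      have hf₂iff : f₂ ≠ 0 ↔ f ≠ 0 ∨ Good N W := by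
        rw [← hgood]; omega
      have h5 := computes_jump (c := ⟨83, Store.mem (regs N (W + W) (N + N - (W + W)) f₂ 0 0 0,
        T₂)⟩) (X := (N + 2) ^ 10) (t := 8) rfl
        (mem_le (by omega) (by omega) (by omega)
          (by omega) hf₂le (by omega) (by omega) (by omega) hT₂le)
      -- The next table starts `W * (8 * N ^ 2)` cells further on, beyond both the swept table and
      -- the mark at `p + W`.
      have hT₂0 : ∀ a, 20 + (W + W) * N * (8 * N) ≤ a → T₂ a = 0 := by
        intro a ha
        have h6 : N * (8 * N) ≤ W * (N * (8 * N)) := Nat.le_mul_of_pos_left _ hW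
        have h7 : (W + W) * N * (8 * N) = W * N * (8 * N) + W * (N * (8 * N)) := by ring
        have h8 : W * 1 ≤ W * (N * (8 * N)) := by
          have : 0 < N := by omega
          exact Nat.mul_le_mul_left W (by positivity : 0 < N * (8 * N))
        rw [hT₂, sweep_of_le hWN' (by omega)]
        by_cases ha' : a = p + W
        · have h9 : W * 2 ≤ W * (N * (8 * N)) := by
            have h10 : 1 * (8 * 1) ≤ N * (8 * N) := by gcongr <;> omega
            exact Nat.mul_le_mul_left W (by omega)
          omega
        · rw [hT₁, Function.update_of_ne ha']
          exact hT0 a (by omega)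
      obtain ⟨W', f', T', g1, g2, g3, g4, g5⟩ := ih (W := W + W) (f := f₂) (T := T₂)
        (by rw [pow_succ] at hk; linarith) (by omega) (by omega) hf₂le hT₂le hT₂0
      refine ⟨W', f', T', g1, g2, g3, ?_, ?_⟩
      · rw [g4, hf₂iff, or_assoc]
        refine or_congr_right ⟨?_, ?_⟩
        · rintro (h | ⟨L, h, h'⟩)
          · exact ⟨0, by simpa using hWN', by simpa using h⟩
          · have : (W + W) * 2 ^ L = W * 2 ^ (L + 1) := by ring
            exact ⟨L + 1, this ▸ h, this ▸ h'⟩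
        · rintro ⟨L, h, h'⟩
          rcases L with - | L
          · exact Or.inl (by simpa using h')
          · have : (W + W) * 2 ^ L = W * 2 ^ (L + 1) := by ring
            exact Or.inr ⟨L, this ▸ h, this ▸ h'⟩
      · have hl2 : tableCode.length = 12 := rfl
        have hl4 : inspectCode.length = 18 := rfl
        rw [hl2] at h2
        rw [hl4] at h4
        -- Here `1584 = 36 * 44`, and `33 = 1 + 12 + 1 + 18 + 1` collects the tests, the two blocks
        -- and the jump.
        refine (h1.trans (h2.trans (h3.trans (h4.trans (h5.trans g5))))).mono le_rfl ?_
        rw [Nat.succ_mul k]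
        omega
    -- The search is already over, so the unused round is only slack in the time bound.
    · have hx : N + N - W = 0 := by omega
      have hle : W ≤ W * 2 ^ k := Nat.le_mul_of_pos_right _ (by positivity)
      obtain ⟨W', f', T', g1, g2, g3, g4, g5⟩ := ih (by omega) hW hWN hf hT hT0
      exact ⟨W', f', T', g1, g2, g3, g4, g5.mono le_rfl
        (Nat.add_le_add_right (Nat.mul_le_mul_right _ (Nat.le_succ k)) 1)⟩

/-- A bound for the running time. -/
def runningTime (N : ℕ) : ℕ := (Nat.log 2 N + 2) * (1584 * N ^ 4 + 33) + 15

theorem program_computes (N : ℕ) :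
    ∃ m : ℕ → ℕ, (IsPalindromicQuotient N → m 0 = 1) ∧ (¬ IsPalindromicQuotient N → m 0 = 0) ∧
      Computes program (((N + 2) ^ 10) ^ 2 ^ 64) (runningTime N) (start N) ⟨90, m⟩ := by
  have hX : (N + 2) * 2 ^ 9 ≤ (N + 2) ^ 10 := by
    rw [pow_succ' (N + 2) 9]
    gcongr
    omega
  have hstart : start N = ⟨0, Store.mem (N :: List.replicate 19 0, fun _ => 0)⟩ := by
    unfold start
    congr 1
    funext a
    unfold Store.mem
    rcases a with - | a
    · simp
    · simp [List.getElem?_replicate, -List.reduceReplicate]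
      split_ifs <;> simp
  have h1 := computes_code (is := initCode) (off := 0) rfl (by decide)
    (admissibleAll_initCode N fun _ => 0) (X := (N + 2) ^ 10) (by omega) (by decide)
    (Store.mem_le (by simp; omega) (by simp))
  rw [actAll_initCode, ← hstart] at h1
  obtain ⟨W', f', T', g1, g2, g3, g4, g5⟩ := computes_search (N := N) (Nat.log 2 N + 2) (W := 1)
    (f := 0) (T := fun _ => 0) (by
      have := Nat.lt_pow_succ_log_self (b := 2) (by norm_num) N
      rw [pow_succ]; omega) (by omega) (by omega) (by omega) (by simp) (by simp)
  have h2 := computes_code (is := outputCode) (off := 84) rfl (by decide)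
    (admissibleAll_outputCode N W' 0 f' T') (X := (N + 2) ^ 10) (by omega) (by decide)
    (mem_le (by omega) (by omega) (by omega) (by omega) g2 (by omega) (by omega) (by omega) g3)
  -- The factor `N % 2` rejects even `N`, and the truncated `1 - N` accepts exactly `N = 0`.
  have hout : (actAll outputCode (regs N W' 0 f' 0 0 0, T')).mem 0 = f' * (N % 2) + (1 - N) := by
    rw [Nat.mod_eq_sub_div_mul]
    rfl
  have hiff : IsPalindromicQuotient N ↔ N = 0 ∨ N % 2 = 1 ∧ f' ≠ 0 := by
    rw [isPalindromicQuotient_iff_good, g4]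
    simp
  refine ⟨_, ?_, ?_, (h1.trans (g5.trans h2)).mono le_rfl ?_⟩
  · rw [hout, hiff]
    rintro (rfl | ⟨h, h'⟩)
    · simp
    · rw [h]; omega
  · rw [hout, hiff]
    intro h
    rcases Nat.mod_two_eq_zero_or_one N with h' | h'
    · rw [h']; omega
    · rw [h']; omega
  · have hl1 : initCode.length = 8 := rfl
    have hl2 : outputCode.length = 6 := rfl
    rw [hl1, hl2, runningTime]
    omega

theorem program_decidesInTime :
    program.DecidesInTime {N : ℕ | IsPalindromicQuotient N} runningTime := by
  have key : ∀ N : ℕ, program.Halted (program.configAt N (runningTime N)) ∧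
      (IsPalindromicQuotient N → (program.configAt N (runningTime N)).mem 0 = 1) ∧
      (¬ IsPalindromicQuotient N → (program.configAt N (runningTime N)).mem 0 = 0) ∧
      ∀ t a, (program.configAt N t).mem a ≤ ((N + 2) ^ 10) ^ 2 ^ 64 := by
    intro N
    obtain ⟨m, h1, h2, h3⟩ := program_computes N
    have hhalt : program.Halted ⟨90, m⟩ := le_of_eq rfl
    obtain ⟨h4, h5⟩ := h3.halted hhalt
    rw [h4]
    exact ⟨hhalt, h1, h2, h5⟩
  refine ⟨fun N => ⟨(key N).1, (key N).2.1, (key N).2.2.1⟩, 10 * 2 ^ 64, fun N t a => ?_⟩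
  rw [pow_mul]
  exact (key N).2.2.2 t a

theorem runningTime_isBigO :
    Asymptotics.IsBigO Filter.atTop (fun N : ℕ => (runningTime N : ℝ))
      (fun N : ℕ => (N : ℝ) ^ (9 / 2 : ℝ)) := by
  refine Asymptotics.IsBigO.of_bound (6 * 1617 + 15) ?_
  filter_upwards [Filter.eventually_ge_atTop 1] with N hN
  have hN' : (1 : ℝ) ≤ N := by exact_mod_cast hN
  have hN0 : (0 : ℝ) < N := by linarith
  -- The constant `4` comes from `log N ≤ 2 * N ^ (1 / 2)` and `log 2 ≥ 1 / 2`; this absorbs the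
  -- logarithm into `N ^ (1 / 2)`.
  have hlog : (Nat.log 2 N : ℝ) ≤ 4 * (N : ℝ) ^ (1 / 2 : ℝ) := by
    have h1 : (Nat.log 2 N : ℝ) ≤ Real.log N / Real.log 2 := by
      simpa [Real.logb] using Real.natLog_le_logb N 2
    have h2 : Real.log N ≤ (N : ℝ) ^ (1 / 2 : ℝ) / (1 / 2) :=
      Real.log_le_rpow_div hN0.le (by norm_num)
    have h3 : (1 / 2 : ℝ) ≤ Real.log 2 := by linarith [Real.log_two_gt_d9]
    have h4 : Real.log N / Real.log 2 ≤ Real.log N / (1 / 2) :=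
      div_le_div_of_nonneg_left (Real.log_nonneg hN') (by norm_num) h3
    linarith
  have hsqrt : (1 : ℝ) ≤ (N : ℝ) ^ (1 / 2 : ℝ) := Real.one_le_rpow hN' (by norm_num)
  have hpow : (1 : ℝ) ≤ (N : ℝ) ^ 4 := one_le_pow₀ hN'
  have hsplit : (N : ℝ) ^ (9 / 2 : ℝ) = (N : ℝ) ^ (1 / 2 : ℝ) * (N : ℝ) ^ 4 := by
    rw [← Real.rpow_natCast (N : ℝ) 4, ← Real.rpow_add hN0]
    norm_num
  have hone : (1 : ℝ) ≤ (N : ℝ) ^ (1 / 2 : ℝ) * (N : ℝ) ^ 4 :=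
    one_le_mul_of_one_le_of_one_le hsqrt hpow
  rw [hsplit, Real.norm_of_nonneg (Nat.cast_nonneg _), Real.norm_of_nonneg (by positivity),
    runningTime]
  push_cast
  have h5 : ((Nat.log 2 N : ℝ) + 2) * (1584 * (N : ℝ) ^ 4 + 33) ≤
      (6 * (N : ℝ) ^ (1 / 2 : ℝ)) * (1617 * (N : ℝ) ^ 4) := by
    gcongr
    · linarith
    · linarith
  linarith

end PalindromicQuotient

theorem theorem4 :
    ∃ (P : RAM.Program) (T : ℕ → ℕ),
      P.DecidesInTime {N : ℕ | IsPalindromicQuotient N} T ∧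
      Asymptotics.IsBigO Filter.atTop (fun N : ℕ => (T N : ℝ))
        (fun N : ℕ => (N : ℝ) ^ (9 / 2 : ℝ)) :=
  ⟨PalindromicQuotient.program, PalindromicQuotient.runningTime,
    PalindromicQuotient.program_decidesInTime, PalindromicQuotient.runningTime_isBigO⟩
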